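/- Let $G$ be a finite group. All representations and characters are over $\mathbb{C}$; $\operatorname{Irr}(G)$ denotes the set of characters of irreducible finite-dimensional complex representations of $G$, the degree of a character $\chi$ is $\chi(1)$, and $\ker\chi$ is the kernel of a representation with character $\chi$. A character $\chi$ of $G$ is called monomial if $\chi=\lambda^G$ is induced from a linear character $\lambda$ (the character of a one-dimensional representation) of some subgroup $H\le G$, and $G$ is called an $M$-group if every $\chi\in\operatorname{Irr}(G)$ is monomial. Put $G^{(0)}=G$ and $G^{(i)}=[G^{(i-1)},G^{(i-1)}]$ for $i\ge 1$. Then the following hold. 1. Let $G$ be an $M$-group, and let $1=d_1<d_2<\dots<d_k$ be all the distinct degrees of the irreducible characters of $G$. If $\chi\in\operatorname{Irr}(G)$ has degree $d_i$, then $G^{(i)}\le\ker\chi$. 2. Every $M$-group is solvable: if $G$ is an $M$-group, then $G$ is solvable. 3. Every nilpotent group is an $M$-group: if $G$ is nilpotent, then $G$ is an $M$-group. -/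

import Mathlib

/-- `Irr(G)`: the set of characters of irreducible complex representations
`G → GL_n(ℂ)`, `n` arbitrary. -/
def irr (G : Type*) [Group G] : Set (G → ℂ) :=
  {χ | ∃ (n : ℕ) (ρ : Representation ℂ G (Fin n → ℂ)), ρ.IsIrreducible ∧ ρ.character = χ}

/-- The set of degrees `χ(1)` of the irreducible complex characters of `G`. -/
def irrDegrees (G : Type*) [Group G] : Set ℕ :=
  {d | ∃ χ ∈ irr G, χ 1 = (d : ℂ)}

/-- A complex function on `G` is a monomial character if it is the character of the representation
of `G` induced from a one-dimensional complex representation of some subgroup `H` of `G`. -/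
def IsMonomialCharacter {G : Type*} [Group G] (χ : G → ℂ) : Prop :=
  ∃ (H : Subgroup G) (σ : Representation ℂ H ℂ), (Representation.ind H.subtype σ).character = χ

/-- `G` is an `M`-group if every irreducible complex character of `G` is monomial. -/
def IsMGroup (G : Type*) [Group G] : Prop :=
  ∀ χ ∈ irr G, IsMonomialCharacter χ

/-! Taketa's argument: let an irreducible `ρ` be induced from a linear character of `H`, so its
degree is the index of `H`. If `H ≠ G`, the permutation module on `G ⧸ H` has an invariant line, so
all its irreducible submodules have smaller degree. A subgroup `N` killed by all smaller degrees
thus fixes every coset, whence `N ≤ H`. Now `H` acts by scalars on some `v ≠ 0`, so `⁅N, N⁆` fixes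
`v` and, for normal `N`, acts trivially by irreducibility. Taking `N` to be the previous derived
subgroup gives the first claim by induction; faithfulness of the regular representation then gives
solvability.

For nilpotent groups it suffices to find an eigenvector of a subgroup of index at most the degree:
the induced module then maps onto `V`, and dimensions force an isomorphism. The subgroup comes from
induction on dimension, passing to an eigenspace of a nonscalar element whose commutators are all
scalar. -/

open Module
open scoped commutatorElement

namespace Representation

/-! ### Irreducibility, equivalence and complete reducibility -/

section Irreducible

variable {k G V W : Type*} [Group G] [Field k] [AddCommGroup V] [Module k V]
  [AddCommGroup W] [Module k W]

/-- Irreducibility in terms of invariant submodules. -/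
theorem isIrreducible_iff_forall_submodule (ρ : Representation k G V) :
    ρ.IsIrreducible ↔ Nontrivial V ∧ ∀ W : Submodule k V,
      (∀ g, ∀ v ∈ W, ρ g v ∈ W) → W = ⊥ ∨ W = ⊤ := by
  constructor
  · intro h
    refine ⟨?_, fun W hW => ?_⟩
    · by_contra hV
      rw [not_nontrivial_iff_subsingleton] at hV
      refine bot_ne_top (α := Subrepresentation ρ) ?_
      exact Subrepresentation.toSubmodule_injective (Subsingleton.elim _ _)
    · rcases h.eq_bot_or_eq_top ⟨W, hW⟩ with h1 | h1
      · exact Or.inl (congrArg Subrepresentation.toSubmodule h1)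
      · exact Or.inr (congrArg Subrepresentation.toSubmodule h1)
  · rintro ⟨_, h⟩
    refine { exists_pair_ne := ⟨⊥, ⊤, fun h => ?_⟩, eq_bot_or_eq_top := fun S => ?_ }
    · exact bot_ne_top (α := Submodule k V) (congrArg Subrepresentation.toSubmodule h)
    · rcases h S.toSubmodule S.apply_mem_toSubmodule with h1 | h1
      · exact Or.inl (Subrepresentation.toSubmodule_injective h1)
      · exact Or.inr (Subrepresentation.toSubmodule_injective h1)

theorem Equiv.isIrreducible {ρ : Representation k G V} {σ : Representation k G W}
    (e : ρ.Equiv σ) (h : ρ.IsIrreducible) : σ.IsIrreducible := by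
  rw [isIrreducible_iff_forall_submodule] at h ⊢
  obtain ⟨_, h⟩ := h
  refine ⟨e.toLinearEquiv.symm.toEquiv.nontrivial, fun U hU => ?_⟩
  rcases h (U.comap e.toLinearEquiv.toLinearMap) (fun g v hv => by
    have := hU g _ hv
    rwa [Submodule.mem_comap, show e.toLinearEquiv.toLinearMap (ρ g v) =
      σ g (e.toLinearEquiv.toLinearMap v) from IntertwiningMap.isIntertwining _ _ e.toIntertwiningMap g v]) with h1 | h1
  · left
    rw [eq_bot_iff]
    intro w hw
    obtain ⟨v, rfl⟩ := e.toLinearEquiv.surjective w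
    have : v ∈ U.comap e.toLinearEquiv.toLinearMap := hw
    rw [h1, Submodule.mem_bot] at this
    simp [this]
  · right
    rw [eq_top_iff]
    intro w _
    obtain ⟨v, rfl⟩ := e.toLinearEquiv.surjective w
    have : v ∈ U.comap e.toLinearEquiv.toLinearMap := h1 ▸ Submodule.mem_top
    exact this

theorem Equiv.ker_le {ρ : Representation k G V} {σ : Representation k G W}
    (e : ρ.Equiv σ) : MonoidHom.ker ρ ≤ MonoidHom.ker σ := by
  intro g hg
  rw [MonoidHom.mem_ker] at hg ⊢
  ext w
  obtain ⟨v, rfl⟩ := e.toLinearEquiv.surjective w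
  have := IntertwiningMap.isIntertwining _ _ e.toIntertwiningMap g v
  rw [hg] at this
  exact this.symm

/-- Every finite-dimensional representation is equivalent to one on a coordinate space. -/
theorem exists_equiv_fin [FiniteDimensional k V] (ρ : Representation k G V) :
    ∃ τ : Representation k G (Fin (finrank k V) → k), Nonempty (ρ.Equiv τ) := by
  let e : V ≃ₗ[k] (Fin (finrank k V) → k) := (finBasis k V).equivFun
  refine ⟨(e.conjAlgEquiv k).toAlgHom.toRingHom.toMonoidHom.comp ρ, ⟨Equiv.mk e fun g => ?_⟩⟩
  ext v : 1
  simp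

/-- If `g` acts trivially on every irreducible subrepresentation, it acts trivially. -/
theorem apply_eq_one_of_forall_irreducible [Finite G] [NeZero (Nat.card G : k)]
    (ρ : Representation k G V) (g : G)
    (h : ∀ S : Subrepresentation ρ, S.toRepresentation.IsIrreducible → ∀ v ∈ S, ρ g v = v) :
    ρ g = 1 := by
  have hs : IsSemisimpleModule (MonoidAlgebra k G) ρ.asModule :=
    (isSemisimpleRepresentation_iff_isSemisimpleModule_asModule ρ).1 inferInstance
  have key : ∀ v : ρ.asModule, v ∈ (⊤ : Submodule (MonoidAlgebra k G) ρ.asModule) →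
      ρ g (ρ.asModuleEquiv v) = ρ.asModuleEquiv v := by
    intro v hv
    -- By Maschke every vector is a sum of vectors from simple submodules.
    rw [← IsSemisimpleModule.sSup_simples_eq_top, sSup_eq_iSup'] at hv
    induction hv using Submodule.iSup_induction' with
    | mem N v hv =>
      obtain ⟨N, hN⟩ := N
      refine h (Subrepresentation.ofSubmodule' N) ?_ v hv
      have hN : IsSimpleModule (MonoidAlgebra k G) N := hN
      rw [isIrreducible_iff_forall_submodule]
      refine ⟨IsSimpleModule.nontrivial (MonoidAlgebra k G) N, fun U hU => ?_⟩
      let S : Subrepresentation ρ :=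
        ⟨U.map (Subrepresentation.ofSubmodule' N).toSubmodule.subtype, by
          rintro g _ ⟨u, hu, rfl⟩
          exact ⟨_, hU g u hu, rfl⟩⟩
      have hat : IsAtom N := isSimpleModule_iff_isAtom.1 hN
      have hle : S.asSubmodule ≤ N := by
        rintro _ ⟨u, hu, rfl⟩
        exact u.2
      rcases hat.le_iff.1 hle with h1 | h1
      · left
        rw [eq_bot_iff]
        intro u hu
        have : (u : V) ∈ S.asSubmodule := ⟨u, hu, rfl⟩
        rw [h1] at this
        exact Subtype.ext this
      · right
        rw [eq_top_iff]
        intro u _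
        have : (u : V) ∈ S.asSubmodule := h1.symm.le u.2
        obtain ⟨u', hu', h2⟩ := this
        rwa [← Subtype.ext h2]
    | zero => simp
    | add x y _ _ hx hy => simp [hx, hy]
  ext v
  exact key v Submodule.mem_top

end Irreducible

/-! ### Characters determine irreducible representations -/

section Character

variable {G V W : Type*} [Group G] [Finite G] [AddCommGroup V] [Module ℂ V]
  [FiniteDimensional ℂ V] [AddCommGroup W] [Module ℂ W] [FiniteDimensional ℂ W]

/-- A representation with the character of an irreducible one is equivalent to it. -/
theorem nonempty_equiv_of_character_eq (ρ : Representation ℂ G V) (σ : Representation ℂ G W)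
    (hρ : ρ.IsIrreducible) (h : σ.character = ρ.character) : Nonempty (ρ.Equiv σ) := by
  have := Fintype.ofFinite G
  have hne : (Nat.card G : ℂ) ≠ 0 := Nat.cast_ne_zero.2 Nat.card_pos.ne'
  have := invertibleOfNonzero hne
  -- The dimension of the Hom space depends only on the characters, so Schur's lemma for `ρ`
  -- computes it.
  have h1 : (finrank ℂ (IntertwiningMap ρ σ) : ℂ) = 1 := by
    rw [← card_inv_mul_sum_char_mul_char_eq_finrank ρ σ, h,
      card_inv_mul_sum_char_mul_char_eq_finrank ρ ρ, IsIrreducible.finrank_intertwiningMap_self,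
      Nat.cast_one]
  have h2 : finrank ℂ (IntertwiningMap ρ σ) = 1 := by exact_mod_cast h1
  obtain ⟨f, hf⟩ := finrank_pos_iff_exists_ne_zero.1 (h2 ▸ Nat.one_pos)
  have hinj : Function.Injective f.toLinearMap :=
    (IsIrreducible.injective_or_eq_zero f).resolve_right hf
  have hd : finrank ℂ V = finrank ℂ W := by
    have := congrFun h 1
    rw [char_one, char_one] at this
    exact_mod_cast this.symm
  exact ⟨f.ofBijective
    ⟨hinj, (LinearMap.injective_iff_surjective_of_finrank_eq_finrank hd).1 hinj⟩⟩

end Character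

end Representation

/-! ### Eigenvectors for nilpotent groups -/

namespace Representation

variable {G V : Type*} [Group G] [AddCommGroup V] [Module ℂ V]

/-- A nonzero representation of a finite nilpotent group has a common eigenvector for a subgroup
of index at most the dimension. -/
theorem exists_subgroup_eigenvector_index_le [Finite G] [Group.IsNilpotent G]
    [FiniteDimensional ℂ V] [Nontrivial V] (ρ : Representation ℂ G V) :
    ∃ (H : Subgroup G) (v : V), v ≠ 0 ∧ (∀ h ∈ H, ∃ c : ℂ, ρ h v = c • v) ∧
      H.index ≤ finrank ℂ V := by
  classical
  induction hd : finrank ℂ V using Nat.strong_induction_on generalizing G V with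
  | _ d ih =>
  subst hd
  by_cases hS : ∀ g, ∃ c : ℂ, ρ g = c • 1
  · obtain ⟨v, hv⟩ := exists_ne (0 : V)
    refine ⟨⊤, v, hv, fun h _ => ?_, ?_⟩
    · obtain ⟨c, hc⟩ := hS h
      exact ⟨c, by simp [hc]⟩
    · rw [Subgroup.index_top]
      exact finrank_pos
  obtain ⟨n, hn⟩ := Group.IsNilpotent.nilpotent G
  -- With `n` least, commutators of `x` lie one term lower and so act as scalars.
  have hex : ∃ n, ∃ x ∈ Subgroup.upperCentralSeries G n, ¬ ∃ c : ℂ, ρ x = c • 1 := by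
    push Not at hS
    obtain ⟨g, hg⟩ := hS
    exact ⟨n, g, hn ▸ Subgroup.mem_top g, by push Not; exact hg⟩
  obtain ⟨x, hx, hxs⟩ := Nat.find_spec hex
  have hmin := fun m hm => Nat.find_min (m := m) hex hm
  have hcomm : ∀ g : G, ∃ c : ℂ, ρ ⁅x, g⁆ = c • 1 := by
    intro g
    rcases hk : Nat.find hex with _ | m
    · rw [hk, Subgroup.upperCentralSeries_zero, Subgroup.mem_bot] at hx
      exact ⟨1, by simp [hx]⟩
    · rw [hk, Subgroup.mem_upperCentralSeries_succ_iff] at hx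
      have := hmin m (by omega)
      push Not at this
      exact this _ (hx g)
  choose c hc using hcomm
  have hinv : ∀ g : G, ∀ v, ρ g⁻¹ (ρ g v) = v := ρ.inv_self_apply
  -- Hence `ρ g` carries the `a`-eigenspace of `ρ x` into the `c g * a`-eigenspace.
  have hxg : ∀ g v, ρ x (ρ g v) = c g • ρ g (ρ x v) := by
    intro g v
    have : x * g = ⁅x, g⁆ * (g * x) := by simp [commutatorElement_def, mul_assoc]
    rw [← Module.End.mul_apply, ← map_mul, this, map_mul, hc, map_mul]
    simp
  obtain ⟨a, ha⟩ := Module.End.exists_eigenvalue (ρ x)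
  have ha0 : a ≠ 0 := by
    rintro rfl
    obtain ⟨v, hv⟩ := ha.exists_hasEigenvector
    have h0 := hv.apply_eq_smul
    rw [zero_smul] at h0
    exact hv.2 (by rw [← hinv x v, h0, map_zero])
  have hc0 : ∀ g, c g ≠ 0 := by
    intro g h0
    obtain ⟨v, hv⟩ := exists_ne (0 : V)
    have h1 := hxg g v
    rw [h0, zero_smul] at h1
    exact hv (by rw [← hinv g v, ← hinv x (ρ g v), h1, map_zero, map_zero])
  let T : Subgroup G :=
    { carrier := {g | ∀ v, ρ x (ρ g v) = ρ g (ρ x v)}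
      one_mem' := by simp
      mul_mem' := fun {g h} hg hh v => by
        simp only [Set.mem_ofPred_eq] at hg hh
        rw [map_mul, Module.End.mul_apply, hg, hh, Module.End.mul_apply]
      inv_mem' := fun {g} hg v => by
        simp only [Set.mem_ofPred_eq] at hg
        rw [← ρ.inv_self_apply g (ρ x (ρ g⁻¹ v)), ← hg, ρ.self_inv_apply] }
  let E : Submodule ℂ V := Module.End.eigenspace (ρ x) a
  have hE : ∀ v, v ∈ E ↔ ρ x v = a • v := fun v => Module.End.mem_eigenspace_iff
  have hEtop : E < ⊤ := by
    rw [lt_top_iff_ne_top]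
    intro h
    refine hxs ⟨a, ?_⟩
    ext v
    exact (hE v).1 (h ▸ Submodule.mem_top)
  have hEne : Nontrivial E := Submodule.nontrivial_iff_ne_bot.2 ha
  let τ : Representation ℂ T E := Representation.subrepresentation (ρ.comp T.subtype) E (fun g v hv => by
    rw [Submodule.mem_comap, hE]
    rw [hE] at hv
    have := g.2 v
    change ρ x (ρ g v) = a • ρ g v
    rw [this, hv, map_smul])
  obtain ⟨H, v, hv, hHv, hH⟩ := ih (finrank ℂ E) (Submodule.finrank_lt hEtop.ne) τ rfl
  refine ⟨H.map T.subtype, v, by simpa using hv, ?_, ?_⟩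
  · rintro _ ⟨h, hh, rfl⟩
    obtain ⟨b, hb⟩ := hHv h hh
    exact ⟨b, congrArg Subtype.val hb⟩
  rw [Subgroup.index_map_subtype]
  -- Distinct cosets of `T`, the centralizer of `ρ x`, move `E` into different eigenspaces.
  have hq : ∀ q r : G ⧸ T, c q.out * a = c r.out * a → q = r := by
    intro q r hqr
    have hcc := mul_right_cancel₀ ha0 hqr
    rw [← q.out_eq', ← r.out_eq']
    refine QuotientGroup.eq.2 fun v => ?_
    have h1 := hxg r.out v
    have h2 := hxg q.out (ρ (q.out⁻¹ * r.out) v)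
    rw [← hcc] at h1
    rw [← Module.End.mul_apply (ρ q.out), ← map_mul, mul_inv_cancel_left, h1] at h2
    have h3 := smul_right_injective V (hc0 q.out) h2
    have h4 := congrArg (ρ q.out⁻¹) h3
    rw [hinv] at h4
    rw [← h4, map_mul, Module.End.mul_apply]
  have : Fintype (G ⧸ T) := Fintype.ofFinite _
  let Φ : (G ⧸ T → E) →ₗ[ℂ] V :=
    ∑ q : G ⧸ T, (ρ q.out ∘ₗ E.subtype) ∘ₗ LinearMap.proj q
  have hΦ : ∀ f, Φ f = ∑ q : G ⧸ T, ρ q.out (f q) := by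
    intro f
    simp [Φ]
  -- Eigenspaces are independent, so the translates of `E` form a direct sum and `T.index * dim E ≤
  -- dim V`.
  have hinj : Function.Injective Φ := by
    rw [injective_iff_map_eq_zero]
    intro f hf
    rw [hΦ] at hf
    have hind := (Module.End.eigenspaces_iSupIndep (ρ x)).comp
      (f := fun q : G ⧸ T => c q.out * a) (fun q r => hq q r)
    have hz := (iSupIndep_iff_finsetSum_eq_zero_imp_eq_zero _).1 hind Finset.univ
      (fun q => ρ q.out (f q)) (fun q _ => by
        refine Module.End.mem_eigenspace_iff.2 ?_
        rw [hxg, (hE _).1 (f q).2, map_smul, smul_smul]) hf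
    ext q
    have h0 := hz q (Finset.mem_univ q)
    rw [Pi.zero_apply, ZeroMemClass.coe_zero, ← hinv q.out (f q), h0, map_zero]
  have hle := LinearMap.finrank_le_finrank_of_injective hinj
  rw [finrank_pi_fintype, Finset.sum_const, Finset.card_univ, smul_eq_mul,
    ← Nat.card_eq_fintype_card] at hle
  calc H.index * T.index ≤ finrank ℂ E * T.index := Nat.mul_le_mul_right _ hH
    _ ≤ _ := by rw [mul_comm]; exact hle

end Representation

namespace Representation

/-! ### Representations induced from one-dimensional ones -/

section Induced

variable {k G : Type*} [Group G] [Field k] {H : Subgroup G} (σ : Representation k H k)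

theorem IndV.mk_subgroup_mul (h : H) (g : G) (a : k) :
    IndV.mk H.subtype σ (h * g) (σ h a) = IndV.mk H.subtype σ g a := by
  have := Coinvariants.mk_self_apply
    (Representation.tprod ((leftRegular k G).comp H.subtype) σ) h
    (TensorProduct.tmul k (MonoidAlgebra.single g 1) a)
  simpa using this

variable (H) in
/-- Linear maps out of an induced representation, prescribed on generators. -/
theorem exists_indV_lift {W : Type*} [AddCommGroup W] [Module k W] (F : G → k →ₗ[k] W)
    (hF : ∀ (h : H) g a, F (h * g) (σ h a) = F g a) :
    ∃ Ψ : IndV H.subtype σ →ₗ[k] W, ∀ g a, Ψ (IndV.mk H.subtype σ g a) = F g a := by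
  refine ⟨Coinvariants.lift _ (TensorProduct.lift <| (Finsupp.lift _ _ _ F) ∘ₗ
      (MonoidAlgebra.coeffLinearEquiv k).toLinearMap) fun h => ?_, fun g a => ?_⟩
  · ext g
    simpa using hF h g 1
  · simp

theorem finrank_indV [Finite G] : finrank k (IndV H.subtype σ) = H.index := by
  classical
  have : Fintype (G ⧸ H) := Fintype.ofFinite _
  have hmem : ∀ g : G, g * (QuotientGroup.mk g⁻¹ : G ⧸ H).out ∈ H := fun g => by
    have := QuotientGroup.eq.1 (QuotientGroup.out_eq' (QuotientGroup.mk g⁻¹ : G ⧸ H)).symm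
    simpa using this
  -- The generators are identified along right cosets `H g`; inverting representatives of left
  -- cosets gives representatives of these.
  let Φ : (G ⧸ H → k) →ₗ[k] IndV H.subtype σ :=
    ∑ q : G ⧸ H, IndV.mk H.subtype σ q.out⁻¹ ∘ₗ LinearMap.proj q
  have hΦ : ∀ q a, Φ (Pi.single q a) = IndV.mk H.subtype σ q.out⁻¹ a := by
    intro q a
    simp only [Φ, LinearMap.sum_apply, LinearMap.comp_apply, LinearMap.proj_apply]
    rw [Finset.sum_eq_single q]
    · simp
    · intro r _ hr
      simp [Pi.single_eq_of_ne hr]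
    · simp
  obtain ⟨Ψ, hΨ⟩ := exists_indV_lift H σ
    (fun g => LinearMap.single k (fun _ : G ⧸ H => k) (QuotientGroup.mk g⁻¹) ∘ₗ
      σ ⟨_, hmem g⟩⁻¹) (by
    intro h g a
    have hq : (QuotientGroup.mk ((h : G) * g)⁻¹ : G ⧸ H) = QuotientGroup.mk g⁻¹ := by
      rw [QuotientGroup.eq]
      simp
    have hs : (⟨_, hmem ((h : G) * g)⟩ : H) = h * ⟨_, hmem g⟩ := by
      ext
      simp [mul_assoc]
    simp only [LinearMap.comp_apply]
    rw [hs, hq, mul_inv_rev, map_mul, Module.End.mul_apply, inv_self_apply])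
  have h1 : Ψ ∘ₗ Φ = LinearMap.id := by
    refine LinearMap.pi_ext fun q a => ?_
    rw [LinearMap.comp_apply, hΦ, hΨ, LinearMap.id_apply, LinearMap.comp_apply]
    have hq : (QuotientGroup.mk (q.out⁻¹)⁻¹ : G ⧸ H) = q := by simp
    have hs : (⟨_, hmem q.out⁻¹⟩ : H) = 1 := by
      ext
      simp
    rw [hs, hq]
    simp
  have h2 : Φ ∘ₗ Ψ = LinearMap.id := by
    refine IndV.hom_ext _ _ fun g => ?_
    refine LinearMap.ext_ring ?_
    change Φ (Ψ (IndV.mk H.subtype σ g 1)) = IndV.mk H.subtype σ g 1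
    rw [hΨ]
    change Φ (Pi.single _ _) = _
    rw [hΦ, ← IndV.mk_subgroup_mul σ ⟨_, hmem g⟩, self_inv_apply]
    congr 1
    simp
  rw [← (LinearEquiv.ofLinearMap Φ Ψ h2 h1).finrank_eq, finrank_fintype_fun_eq_card,
    ← Nat.card_eq_fintype_card]
  rfl

/-- An irreducible representation with an eigenvector for a subgroup of index at most the dimension
is induced from that subgroup. -/
theorem exists_ind_equiv [Finite G] {V : Type*} [AddCommGroup V] [Module k V]
    [FiniteDimensional k V] (ρ : Representation k G V) (hρ : ρ.IsIrreducible) (H : Subgroup G)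
    (v : V) (hv : v ≠ 0) (hH : ∀ h ∈ H, ∃ c : k, ρ h v = c • v) (hi : H.index ≤ finrank k V) :
    ∃ σ : Representation k H k, Nonempty ((ind H.subtype σ).Equiv ρ) := by
  choose c hc using fun h : H => hH h h.2
  have hinj := smul_left_injective k hv
  let σ : Representation k H k :=
    { toFun := fun h => c h • 1
      map_one' := by
        have : c 1 = 1 := hinj (by simp [← hc])
        simp [this]
      map_mul' := fun h h' => by
        have : c (h * h') = c h * c h' := hinj (by
          simp only [← hc]
          rw [Subgroup.coe_mul, map_mul, Module.End.mul_apply, hc, map_smul, hc, smul_smul,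
            mul_comm])
        ext
        simp [this, mul_comm] }
  have hσ : ∀ h a, σ h a = c h * a := fun h a => by simp [σ]
  -- Frobenius reciprocity; the inverse appears because `G` acts on generators by right
  -- multiplication with inverses.
  obtain ⟨Ψ, hΨ⟩ := exists_indV_lift H σ (fun g => (ρ g⁻¹) ∘ₗ LinearMap.toSpanSingleton k V v) (by
    intro h g a
    simp only [LinearMap.comp_apply, LinearMap.toSpanSingleton_apply, hσ]
    rw [mul_comm, mul_smul, ← hc, ← map_smul, mul_inv_rev, map_mul, Module.End.mul_apply,
      inv_self_apply])
  have hΨi : ∀ g, Ψ ∘ₗ ind H.subtype σ g = ρ g ∘ₗ Ψ := by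
    intro g
    refine IndV.hom_ext _ _ fun g' => ?_
    refine LinearMap.ext fun a => ?_
    change Ψ (ind H.subtype σ g (IndV.mk H.subtype σ g' a)) = ρ g (Ψ (IndV.mk H.subtype σ g' a))
    rw [ind_mk, hΨ, hΨ, mul_inv_rev, inv_inv, map_mul]
    rfl
  have hsurj : Function.Surjective Ψ := by
    rw [← LinearMap.range_eq_top]
    refine (((isIrreducible_iff_forall_submodule ρ).1 hρ).2 (LinearMap.range Ψ) ?_).resolve_left ?_
    · rintro g _ ⟨w, rfl⟩
      exact ⟨ind H.subtype σ g w, LinearMap.congr_fun (hΨi g) w⟩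
    · intro h
      have : Ψ (IndV.mk H.subtype σ 1 1) ∈ LinearMap.range Ψ := ⟨_, rfl⟩
      rw [h, hΨ, Submodule.mem_bot] at this
      exact hv (by simpa using this)
  have hfd : FiniteDimensional k (IndV H.subtype σ) := by
    have : Module.Finite k (MonoidAlgebra k G) :=
      Module.Finite.equiv (MonoidAlgebra.coeffLinearEquiv k).symm
    infer_instance
  have hd : finrank k (IndV H.subtype σ) = finrank k V :=
    le_antisymm ((finrank_indV σ).trans_le hi) (LinearMap.finrank_le_finrank_of_surjective hsurj)
  have hbij : Function.Bijective Ψ :=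
    ⟨(LinearMap.injective_iff_surjective_of_finrank_eq_finrank hd).2 hsurj, hsurj⟩
  exact ⟨σ, ⟨Equiv.mk (LinearEquiv.ofBijective Ψ hbij) hΨi⟩⟩

/-- An irreducible representation equivalent to an induced one contains an eigenvector of the
subgroup. -/
theorem Equiv.exists_eigenvector_of_ind {V : Type*} [AddCommGroup V] [Module k V]
    [Nontrivial V] {ρ : Representation k G V} (e : (ind H.subtype σ).Equiv ρ) :
    ∃ v : V, v ≠ 0 ∧ ∀ h ∈ H, ∃ c : k, ρ h v = c • v := by
  have he : ∀ g w, e.toLinearEquiv (ind H.subtype σ g w) = ρ g (e.toLinearEquiv w) :=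
    fun g w => IntertwiningMap.isIntertwining _ _ e.toIntertwiningMap g w
  refine ⟨e.toLinearEquiv (IndV.mk H.subtype σ 1 1), fun h => ?_, fun h hh => ?_⟩
  -- The translates of this vector span the induced space, so it cannot vanish.
  · have h0 : IndV.mk H.subtype σ 1 1 = 0 := by simpa using h
    have hid : (LinearMap.id : IndV H.subtype σ →ₗ[k] _) = 0 := by
      refine IndV.hom_ext _ _ fun g => ?_
      ext
      have := ind_mk H.subtype σ g⁻¹ 1 1
      rw [h0, map_zero] at this
      simpa using this.symm
    obtain ⟨v, hv⟩ := exists_ne (0 : V)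
    refine hv ?_
    obtain ⟨w, rfl⟩ := e.toLinearEquiv.surjective v
    rw [show w = 0 from LinearMap.congr_fun hid w, map_zero]
  · refine ⟨σ ⟨h, hh⟩ 1, ?_⟩
    rw [← he, ← map_smul, ← map_smul, ind_mk]
    congr 1
    have := IndV.mk_subgroup_mul σ (⟨h, hh⟩ : H)⁻¹ 1 (σ ⟨h, hh⟩ 1)
    rw [inv_self_apply] at this
    simpa using this

end Induced
end Representation

/-! ### Taketa's step -/

namespace Representation

variable {G V : Type*} [Group G] [Finite G] [AddCommGroup V] [Module ℂ V] [FiniteDimensional ℂ V]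

/-- If `N` lies in the kernel of all irreducible representations of degree smaller than the index
of `H`, then `N ≤ H`. -/
theorem le_of_forall_irreducible_lt_index (N H : Subgroup G)
    (hN : ∀ (m : ℕ) (τ : Representation ℂ G (Fin m → ℂ)), τ.IsIrreducible → m < H.index →
      N ≤ MonoidHom.ker τ) : N ≤ H := by
  rcases eq_or_ne H ⊤ with rfl | hH
  · exact le_top
  have : Fintype (G ⧸ H) := Fintype.ofFinite _
  intro g hg
  let π : Representation ℂ G (MonoidAlgebra ℂ (G ⧸ H)) := ofMulAction ℂ G (G ⧸ H)
  have hfin : FiniteDimensional ℂ (MonoidAlgebra ℂ (G ⧸ H)) :=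
    Module.Finite.equiv (MonoidAlgebra.coeffLinearEquiv ℂ).symm
  have hdim : finrank ℂ (MonoidAlgebra ℂ (G ⧸ H)) = H.index := by
    rw [(MonoidAlgebra.coeffLinearEquiv ℂ).finrank_eq, finrank_finsupp_self,
      ← Nat.card_eq_fintype_card]
    rfl
  have hπ : π g = 1 := by
    refine apply_eq_one_of_forall_irreducible π g fun S hS v hv => ?_
    have hlt : finrank ℂ S.toSubmodule < H.index := by
      rw [← hdim]
      refine Submodule.finrank_lt fun htop => ?_
      let e : S.toRepresentation.Equiv π := Equiv.mk (LinearEquiv.ofTop _ htop) fun _ => rfl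
      -- The sum of all cosets is invariant: were the whole module irreducible, it would be this
      -- line, forcing `H = ⊤`.
      let w : MonoidAlgebra ℂ (G ⧸ H) := ∑ q : G ⧸ H, MonoidAlgebra.single q 1
      have hw : ∀ g, π g w = w := fun g => by
        simp only [w, π, map_sum, ofMulAction_single]
        exact _root_.Equiv.sum_comp (MulAction.toPerm g) fun q => MonoidAlgebra.single q (1 : ℂ)
      have hw0 : w ≠ 0 := fun h0 => by
        have := congrArg (Finsupp.linearCombination ℂ (fun _ => (1 : ℂ)) ∘ₗ
          (MonoidAlgebra.coeffLinearEquiv ℂ).toLinearMap) h0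
        simp [w] at this
      rcases ((isIrreducible_iff_forall_submodule _).1 (e.isIrreducible hS)).2 (ℂ ∙ w)
        (fun g v hv => by
          obtain ⟨c, rfl⟩ := Submodule.mem_span_singleton.1 hv
          rw [map_smul, hw]
          exact hv) with h1 | h1
      · exact hw0 (Submodule.span_singleton_eq_bot.1 h1)
      · have h2 := finrank_span_singleton (K := ℂ) hw0
        rw [h1, finrank_top, hdim] at h2
        exact hH (Subgroup.index_eq_one.1 h2)
    obtain ⟨τ, ⟨e⟩⟩ := exists_equiv_fin S.toRepresentation
    have h1 := e.symm.ker_le (hN _ τ (e.isIrreducible hS) hlt hg)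
    exact congrArg Subtype.val (LinearMap.congr_fun h1 ⟨v, hv⟩)
  have h1 := LinearMap.congr_fun hπ (MonoidAlgebra.single (QuotientGroup.mk 1) 1)
  rw [ofMulAction_single, Module.End.one_apply] at h1
  have h2 : g • (QuotientGroup.mk 1 : G ⧸ H) = QuotientGroup.mk 1 :=
    MonoidAlgebra.single_left_injective one_ne_zero h1
  rw [MulAction.Quotient.smul_mk, eq_comm, QuotientGroup.eq] at h2
  simpa using h2

/-- Taketa's step: the commutator of a normal subgroup in the kernel of all irreducible
representations of smaller degree lies in the kernel of a monomial irreducible representation. -/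
theorem commutator_le_ker_of_isMonomialCharacter (ρ : Representation ℂ G V)
    (hρ : ρ.IsIrreducible) (hmon : IsMonomialCharacter ρ.character) (N : Subgroup G) [N.Normal]
    (hN : ∀ (m : ℕ) (τ : Representation ℂ G (Fin m → ℂ)), τ.IsIrreducible → m < finrank ℂ V →
      N ≤ MonoidHom.ker τ) : ⁅N, N⁆ ≤ MonoidHom.ker ρ := by
  obtain ⟨H, σ, hσ⟩ := hmon
  have hρ' := (isIrreducible_iff_forall_submodule ρ).1 hρ
  have := hρ'.1
  obtain ⟨e⟩ := nonempty_equiv_of_character_eq ρ (ind H.subtype σ) hρ hσ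
  have hd : finrank ℂ V = H.index := by rw [e.toLinearEquiv.finrank_eq, finrank_indV]
  obtain ⟨v, hv, hHv⟩ := e.symm.exists_eigenvector_of_ind
  have hNH : N ≤ H := le_of_forall_irreducible_lt_index N H (hd ▸ hN)
  have hfix : ∀ g ∈ ⁅N, N⁆, ρ g v = v := by
    let T : Subgroup G :=
      { carrier := {g | ρ g v = v}
        one_mem' := by simp
        mul_mem' := fun {g h} hg hh => by
          simp only [Set.mem_ofPred_eq] at hg hh ⊢
          rw [map_mul, Module.End.mul_apply, hh, hg]
        inv_mem' := fun {g} hg => by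
          simp only [Set.mem_ofPred_eq] at hg ⊢
          rw [inv_apply_eq_iff, hg] }
    refine fun g hg => Subgroup.commutator_le (H₃ := T).2 (fun x hx y hy => ?_) hg
    obtain ⟨a, ha⟩ := hHv x (hNH hx)
    obtain ⟨b, hb⟩ := hHv y (hNH hy)
    have h1 : ρ (y * x) v = (a * b) • v := by
      rw [map_mul, Module.End.mul_apply, ha, map_smul, hb, smul_smul]
    have h2 : ρ (x * y) v = (a * b) • v := by
      rw [map_mul, Module.End.mul_apply, hb, map_smul, ha, smul_smul, mul_comm]
    have hab : a * b ≠ 0 := fun h0 => by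
      rw [h0, zero_smul] at h1
      exact hv ((ρ.apply_bijective (y * x)).1 (h1.trans (map_zero _).symm))
    have h3 : x * y = ⁅x, y⁆ * (y * x) := by simp [commutatorElement_def, mul_assoc]
    rw [h3, map_mul, Module.End.mul_apply, h1, map_smul] at h2
    exact smul_right_injective V hab h2
  let F : Submodule ℂ V := invariants (ρ.comp ⁅N, N⁆.subtype)
  have hF : ∀ w, w ∈ F ↔ ∀ g ∈ ⁅N, N⁆, ρ g w = w := fun w =>
    ⟨fun h g hg => h ⟨g, hg⟩, fun h g => h g g.2⟩
  have htop : F = ⊤ := by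
    refine (hρ'.2 F fun g w hw => le_comap_invariants ρ ⁅N, N⁆ g hw).resolve_left fun h => ?_
    have := (hF v).2 hfix
    rw [h, Submodule.mem_bot] at this
    exact hv this
  intro g hg
  ext w
  exact (hF w).1 (htop ▸ Submodule.mem_top) g hg

end Representation

open Representation

/-! ### Character degrees and M-groups -/

section MGroup

variable (G : Type*) [Group G]

variable {G} in
theorem mem_irrDegrees_iff {d : ℕ} :
    d ∈ irrDegrees G ↔ ∃ ρ : Representation ℂ G (Fin d → ℂ), ρ.IsIrreducible := by
  constructor
  · rintro ⟨_, ⟨n, ρ, hρ, rfl⟩, h⟩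
    rw [char_one, finrank_fin_fun] at h
    obtain rfl : n = d := by exact_mod_cast h
    exact ⟨ρ, hρ⟩
  · rintro ⟨ρ, hρ⟩
    exact ⟨_, ⟨d, ρ, hρ, rfl⟩, by rw [char_one, finrank_fin_fun]⟩

theorem one_mem_irrDegrees : 1 ∈ irrDegrees G := by
  refine mem_irrDegrees_iff.2 ⟨trivial ℂ G _, (isIrreducible_iff_forall_submodule _).2
    ⟨inferInstance, fun U _ => ?_⟩⟩
  have : IsSimpleModule ℂ (Fin 1 → ℂ) := isSimpleModule_iff_finrank_eq_one.2 (by simp)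
  exact eq_bot_or_eq_top U

variable {G} in
theorem pos_of_mem_irrDegrees {d : ℕ} (hd : d ∈ irrDegrees G) : 0 < d := by
  obtain ⟨ρ, hρ⟩ := mem_irrDegrees_iff.1 hd
  have := ((isIrreducible_iff_forall_submodule _).1 hρ).1
  simpa using finrank_pos (R := ℂ) (M := Fin d → ℂ)

/-- The orbit of any nonzero vector spans an irreducible module, so degrees are at most the order of
`G`. -/
theorem finite_irrDegrees [Finite G] : (irrDegrees G).Finite := by
  refine (Set.finite_Iic (Nat.card G)).subset fun d hd => ?_
  obtain ⟨ρ, hρ⟩ := mem_irrDegrees_iff.1 hd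
  rw [isIrreducible_iff_forall_submodule] at hρ
  obtain ⟨_, hρ⟩ := hρ
  obtain ⟨v, hv⟩ := exists_ne (0 : Fin d → ℂ)
  have := Fintype.ofFinite G
  have hle := finrank_range_le_card (R := ℂ) (fun g => ρ g v)
  rw [Set.finrank, (hρ (Submodule.span ℂ (Set.range fun g => ρ g v)) fun g w hw => ?_).resolve_left
    fun h => ?_, finrank_top, finrank_fin_fun, ← Nat.card_eq_fintype_card] at hle
  · exact hle
  · have hm : Submodule.span ℂ (Set.range fun g => ρ g v) ≤
        (Submodule.span ℂ (Set.range fun g => ρ g v)).comap (ρ g) := by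
      rw [Submodule.span_le]
      rintro _ ⟨x, rfl⟩
      exact Submodule.subset_span ⟨g * x, by simp⟩
    exact hm hw
  · have : ρ 1 v ∈ Submodule.span ℂ (Set.range fun g => ρ g v) := Submodule.subset_span ⟨1, rfl⟩
    rw [h, Submodule.mem_bot, map_one] at this
    exact hv this

/-- The degrees of the irreducible characters in increasing order. -/
theorem exists_enumeration_irrDegrees [Finite G] :
    ∃ (k : ℕ) (d : ℕ → ℕ), 1 ≤ k ∧ d 1 = 1 ∧ StrictMonoOn d (Set.Icc 1 k) ∧
      d '' Set.Icc 1 k = irrDegrees G := by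
  have hf : Set.Finite (Set.ofPred (· ∈ irrDegrees G)) := finite_irrDegrees G
  have him := Nat.image_nth_Iio_card hf
  have hmem : ∀ n < hf.toFinset.card, Nat.nth (· ∈ irrDegrees G) n ∈ irrDegrees G :=
    fun n hn => Nat.nth_mem_of_lt_card hf hn
  have hpos : 0 < hf.toFinset.card :=
    Finset.card_pos.2 ⟨1, hf.mem_toFinset.2 (one_mem_irrDegrees G)⟩
  -- `Nat.nth` counts from 0, the degrees from 1.
  refine ⟨hf.toFinset.card, fun i => Nat.nth (· ∈ irrDegrees G) (i - 1), hpos, ?_, ?_, ?_⟩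
  · refine le_antisymm ?_ (pos_of_mem_irrDegrees (hmem 0 hpos))
    change Nat.nth _ 0 ≤ 1
    rw [Nat.nth_zero]
    exact Nat.sInf_le (one_mem_irrDegrees G)
  · rintro i ⟨hi, hi'⟩ j ⟨hj, hj'⟩ hij
    have hi1 : i - 1 < hf.toFinset.card := by omega
    have hj1 : j - 1 < hf.toFinset.card := by omega
    exact Nat.nth_strictMonoOn hf hi1 hj1 (by omega)
  · ext m
    constructor
    · rintro ⟨i, ⟨hi, hi'⟩, rfl⟩
      exact hmem _ (by omega)
    · intro hm
      obtain ⟨i, hi, rfl⟩ := him.symm.subset hm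
      exact ⟨i + 1, ⟨by omega, Set.mem_Iio.1 hi⟩, rfl⟩

variable {G} in
/-- Taketa's theorem for irreducible representations. -/
theorem derivedSeries_le_ker [Finite G] (hG : IsMGroup G) {k : ℕ} {d : ℕ → ℕ}
    (hd : StrictMonoOn d (Set.Icc 1 k)) (him : d '' Set.Icc 1 k = irrDegrees G) (i : ℕ)
    (hi : i ∈ Set.Icc 1 k) {n : ℕ} (ρ : Representation ℂ G (Fin n → ℂ)) (hρ : ρ.IsIrreducible)
    (hn : n = d i) : derivedSeries G i ≤ MonoidHom.ker ρ := by
  induction i using Nat.strong_induction_on generalizing n with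
  | _ i ih =>
  obtain ⟨j, rfl⟩ : ∃ j, i = j + 1 := ⟨i - 1, by have := hi.1; omega⟩
  have := derivedSeries_normal G j
  rw [derivedSeries_succ]
  refine commutator_le_ker_of_isMonomialCharacter ρ hρ (hG _ ⟨n, ρ, hρ, rfl⟩) _
    fun m τ hτ hm => ?_
  obtain ⟨l, hl, rfl⟩ := him.symm.subset (mem_irrDegrees_iff.2 ⟨τ, hτ⟩)
  rw [finrank_fin_fun, hn] at hm
  have hlt := (hd.lt_iff_lt hl hi).1 hm
  -- A smaller degree is `d l` with `l ≤ j`, so its kernel contains the `l`-th, hence the `j`-th,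
  -- derived subgroup.
  exact (derivedSeries_antitone G (Nat.lt_succ_iff.1 hlt)).trans (ih l hlt hl τ hτ rfl)

variable {G} in
/-- An element in the kernel of every irreducible representation is trivial. -/
theorem eq_one_of_forall_irreducible [Finite G] (g : G)
    (h : ∀ (m : ℕ) (τ : Representation ℂ G (Fin m → ℂ)), τ.IsIrreducible →
      g ∈ MonoidHom.ker τ) : g = 1 := by
  have hfin : FiniteDimensional ℂ (MonoidAlgebra ℂ G) :=
    Module.Finite.equiv (MonoidAlgebra.coeffLinearEquiv ℂ).symm
  have h1 : leftRegular ℂ G g = 1 := by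
    refine apply_eq_one_of_forall_irreducible _ g fun S hS v hv => ?_
    obtain ⟨τ, ⟨e⟩⟩ := exists_equiv_fin S.toRepresentation
    exact congrArg Subtype.val
      (LinearMap.congr_fun (e.symm.ker_le (h _ τ (e.isIrreducible hS))) ⟨v, hv⟩)
  have h2 := LinearMap.congr_fun h1 (MonoidAlgebra.single 1 1)
  rw [ofMulAction_single, Module.End.one_apply] at h2
  simpa using MonoidAlgebra.single_left_injective one_ne_zero h2

theorem isMGroup_of_isNilpotent [Finite G] [Group.IsNilpotent G] : IsMGroup G := by
  rintro _ ⟨n, ρ, hρ, rfl⟩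
  have := ((isIrreducible_iff_forall_submodule ρ).1 hρ).1
  obtain ⟨H, v, hv, hH, hi⟩ := exists_subgroup_eigenvector_index_le ρ
  obtain ⟨σ, ⟨e⟩⟩ := exists_ind_equiv ρ hρ H v hv hH hi
  exact ⟨H, σ, char_iso e⟩

end MGroup

theorem mainTheorem5 (G : Type*) [Group G] [Finite G] :
    -- the `i`-th commutant lies in the kernel of the characters of the `i`-th smallest degree
    (IsMGroup G →
      ∃ (k : ℕ) (d : ℕ → ℕ), 1 ≤ k ∧ d 1 = 1 ∧ StrictMonoOn d (Set.Icc 1 k) ∧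
        d '' Set.Icc 1 k = irrDegrees G ∧
        ∀ i ∈ Set.Icc 1 k, ∀ χ ∈ irr G, χ 1 = (d i : ℂ) →
          ∀ (n : ℕ) (ρ : Representation ℂ G (Fin n → ℂ)), ρ.character = χ →
            derivedSeries G i ≤ MonoidHom.ker ρ) ∧
    (IsMGroup G → Group.IsSolvable G) ∧
    (Group.IsNilpotent G → IsMGroup G) := by
  obtain ⟨k, d, hk, hd1, hd, him⟩ := exists_enumeration_irrDegrees G
  refine ⟨fun hG => ⟨k, d, hk, hd1, hd, him, ?_⟩, fun hG => ⟨k, ?_⟩,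
    fun _ => isMGroup_of_isNilpotent G⟩
  · rintro i hi _ ⟨n, ρ, hρ, rfl⟩ hχ m σ hσ
    rw [char_one, finrank_fin_fun] at hχ
    obtain ⟨e⟩ := nonempty_equiv_of_character_eq ρ σ hρ hσ
    exact (derivedSeries_le_ker hG hd him i hi ρ hρ (by exact_mod_cast hχ)).trans e.ker_le
  -- The `k`-th derived subgroup lies in every irreducible kernel, hence is trivial.
  · rw [eq_bot_iff]
    intro g hg
    refine eq_one_of_forall_irreducible g fun m τ hτ => ?_
    obtain ⟨i, hi, rfl⟩ := him.symm.subset (mem_irrDegrees_iff.2 ⟨τ, hτ⟩)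
    exact derivedSeries_le_ker hG hd him i hi τ hτ rfl (derivedSeries_antitone G hi.2 hg)
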